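/- Let $H=(V,E)$ be a finite directed multigraph (loops and parallel arcs allowed) in which every vertex has indegree $2$ and outdegree $2$. A transition system $\tau$ of $H$ chooses for every vertex $v$ a bijection $\tau_v$ from the incoming arcs of $v$ to the outgoing arcs of $v$; it induces the permutation $\pi_\tau(e)=\tau_{\mathrm{head}(e)}(e)$ of $E$, and $\tau$ is an Eulerian tour if $\pi_\tau$ has exactly one cycle (fixed points count as cycles). Let $\mathrm{ET}(H)$ be the set of Eulerian tours. Fix $C\in\mathrm{ET}(H)$, and for $S\subseteq V$ let $C^S$ be the transition system obtained from $C$ by exchanging the two outgoing arcs in the bijection $C_v$ at every $v\in S$ and leaving $C_v$ unchanged at every $v\notin S$. Signed interlacement matrix. The tour $C$ visits each vertex $v$ twice; mark these visits on the oriented circle of the tour (with either orientation) and join the two marks of $v$ by a chord. Choose one endpoint $v^-$ of the chord of each $v$ and let $v^+$ be the other. Vertices $u\neq v$ are interlaced if their four endpoints alternate around the circle. Let $A_C\in\mathbb R^{V\times V}$ have entry $A_C(u,v)=1$ if $u\ne v$ are interlaced and $v^-$ lies on the open arc from $u^-$ to $u^+$, $A_C(u,v)=-1$ if $u\ne v$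 are interlaced and $v^+$ lies on the open arc from $u^-$ to $u^+$, and $A_C(u,v)=0$ otherwise. Theorem (flat skew-determinantal representation). For either orientation and every choice of the endpoints $v^-$, the matrix $A_C$ is skew-symmetric, and for every $S\subseteq V$ $$\det(A_C[S,S])\in\{0,1\},\qquad \det(A_C[S,S])=1\iff C^S\in\mathrm{ET}(H)$$ (where $\det(A_C[\varnothing,\varnothing])=1$). Moreover, $S\mapsto C^S$ is a bijection from the subsets of $V$ to the transition systems of $H$, and under this bijection the uniform distribution on $\mathrm{ET}(H)$ is the measure $$\mu_{A_C}(S)=\frac{\det(A_C[S,S])}{\sum_{T\subseteq V}\det(A_C[T,T])},$$ whose denominator is positive. -/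

import Mathlib

/-- A directed multigraph with vertex type `V` and (distinguishable) arcs `E`.  Parallel arcs and
loops are allowed. -/
structure DiMultigraph (V E : Type*) where
  source : E → V
  target : E → V

namespace DiMultigraph

variable {V E : Type*}

/-- The incoming arcs of `v`. -/
abbrev InArc (H : DiMultigraph V E) (v : V) : Type _ := {e : E // H.target e = v}

/-- The outgoing arcs of `v`; a loop at `v` is both an incoming and an outgoing arc of `v`. -/
abbrev OutArc (H : DiMultigraph V E) (v : V) : Type _ := {e : E // H.source e = v}

/-- Every vertex has indegree two and outdegree two. -/
structure IsTwoInTwoOut (H : DiMultigraph V E) : Prop where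
  card_in : ∀ v, Nat.card (H.InArc v) = 2
  card_out : ∀ v, Nat.card (H.OutArc v) = 2

/-- A transition system: at every vertex a bijection from the incoming to the outgoing arcs. -/
abbrev TransitionSystem (H : DiMultigraph V E) : Type _ := ∀ v : V, H.InArc v ≃ H.OutArc v

/-- The permutation of the arcs induced by a transition system: an arc `e` with target `v` is sent
to `τ v e`. -/
def inducedPerm {H : DiMultigraph V E} (τ : H.TransitionSystem) : Equiv.Perm E :=
  (Equiv.sigmaFiberEquiv H.target).symm.trans
    ((Equiv.sigmaCongrRight τ).trans (Equiv.sigmaFiberEquiv H.source))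

theorem inducedPerm_apply {H : DiMultigraph V E} (τ : H.TransitionSystem) (e : E) :
    inducedPerm τ e = (τ (H.target e) ⟨e, rfl⟩ : E) := rfl

/-- A transition system is an Eulerian tour when its induced permutation has exactly one cycle
(fixed points count as cycles of length one). -/
def IsEulerianTour {H : DiMultigraph V E} (τ : H.TransitionSystem) : Prop :=
  Nonempty E ∧ ∀ e f : E, (inducedPerm τ).SameCycle e f

/-- The set of Eulerian tours of `H`. -/
noncomputable def eulerianTours (H : DiMultigraph V E) [Finite V] [Finite E] :
    Finset H.TransitionSystem :=
  (Set.toFinite {τ : H.TransitionSystem | IsEulerianTour τ}).toFinset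

theorem mem_eulerianTours (H : DiMultigraph V E) [Finite V] [Finite E] (τ : H.TransitionSystem) :
    τ ∈ H.eulerianTours ↔ IsEulerianTour τ := by
  simp [eulerianTours]

/-- The permutation exchanging the two elements of a two-element type. -/
noncomputable def swapTwo {X : Type*} (h : Nat.card X = 2) : Equiv.Perm X :=
  haveI : Finite X := Nat.finite_of_card_ne_zero (by omega)
  (Finite.equivFinOfCardEq h).trans
    ((Equiv.swap (0 : Fin 2) 1).trans (Finite.equivFinOfCardEq h).symm)

theorem swapTwo_ne {X : Type*} (h : Nat.card X = 2) (x : X) : swapTwo h x ≠ x := by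
  haveI : Finite X := Nat.finite_of_card_ne_zero (by omega)
  intro hx
  have h1 : Equiv.swap (0 : Fin 2) 1 (Finite.equivFinOfCardEq h x) = Finite.equivFinOfCardEq h x :=
    (Equiv.symm_apply_eq _).1 hx
  generalize Finite.equivFinOfCardEq h x = i at h1
  revert h1
  revert i
  decide

/-- The transition system `C^S`: at each vertex of `S` the two outgoing arcs are exchanged relative
to `C`, at every other vertex the transition is that of `C`. -/
noncomputable def flip [DecidableEq V] {H : DiMultigraph V E} (hH : H.IsTwoInTwoOut)
    (C : H.TransitionSystem) (S : Finset V) : H.TransitionSystem :=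
  fun v => if v ∈ S then (C v).trans (swapTwo (hH.card_out v)) else C v

/-! ### The chord diagram of a tour

The visits of a tour `C` to the vertices correspond to the arcs: the arc `e` stands for the visit to
its target in which `e` is followed by `inducedPerm C e`.  So the positions on the tour circle are
the arcs, in the cyclic order given by `inducedPerm C` (or by its inverse, for the other orientation
of the circle), and the endpoints of the chord of `v` are the two incoming arcs of `v`. -/

/-- The open arc from `x` to `y` on the circle whose points are cyclically ordered by the
one-cycle permutation `ρ`: the points met strictly after `x` and strictly before `y` when going
around less than one full turn from `x`. -/
def openArc [Fintype E] (ρ : Equiv.Perm E) (x y : E) : Set E :=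
  {z | ∃ i k : ℕ, 0 < i ∧ i < k ∧ k < Fintype.card E ∧ (ρ ^ i) x = z ∧ (ρ ^ k) x = y}

/-- The endpoint of the chord of `v` other than the chosen one `t v`. -/
noncomputable def otherEnd {H : DiMultigraph V E} (hH : H.IsTwoInTwoOut)
    (t : ∀ v, H.InArc v) (v : V) : H.InArc v :=
  swapTwo (hH.card_in v) (t v)

/-- `u` and `v` are interlaced: the four endpoints of their chords alternate around the circle. -/
def Interlaced [Fintype E] {H : DiMultigraph V E} (hH : H.IsTwoInTwoOut) (ρ : Equiv.Perm E)
    (t : ∀ v, H.InArc v) (u v : V) : Prop :=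
  ((t v : E) ∈ openArc ρ (t u) (otherEnd hH t u) ∧
      (otherEnd hH t v : E) ∈ openArc ρ (otherEnd hH t u) (t u)) ∨
    ((otherEnd hH t v : E) ∈ openArc ρ (t u) (otherEnd hH t u) ∧
      (t v : E) ∈ openArc ρ (otherEnd hH t u) (t u))

open Classical in
/-- The signed interlacement matrix, for the cyclic order `ρ` of the tour circle and the chosen
chord tails `t v`. -/
noncomputable def signedInterlacement [Fintype E] {H : DiMultigraph V E} (hH : H.IsTwoInTwoOut)
    (ρ : Equiv.Perm E) (t : ∀ v, H.InArc v) : Matrix V V ℝ :=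
  Matrix.of fun u v =>
    if u = v then 0
    else if Interlaced hH ρ t u v ∧ (t v : E) ∈ openArc ρ (t u) (otherEnd hH t u) then 1
    else if Interlaced hH ρ t u v ∧ (otherEnd hH t v : E) ∈ openArc ρ (t u) (otherEnd hH t u) then
      -1
    else 0

end DiMultigraph

/-- The principal determinant `det (A[S,S])`; it is `1` for `S = ∅`. -/
noncomputable def principalDet {V : Type*} [DecidableEq V] (A : Matrix V V ℝ) (S : Finset V) : ℝ :=
  (A.submatrix (fun i : S => (i : V)) (fun i : S => (i : V))).det

/-- The skew-determinantal measure `μ_A(S) = det (A[S,S]) / ∑ T, det (A[T,T])`. -/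
noncomputable def skewDetMeasure {V : Type*} [Fintype V] [DecidableEq V] (A : Matrix V V ℝ)
    (S : Finset V) : ℝ :=
  principalDet A S / ∑ T : Finset V, principalDet A T

/-! Write `M g = 1 - P_g + J` for `circleMatrix g`. It is singular unless `g` has exactly one cycle,
and since one-cycle permutations are conjugate, `det (M g)` takes a single nonzero value on them.
Hence `det (M (ρ * s)) / det (M ρ)` is 1 or 0 according to whether `ρ * s` has one cycle. Flipping
`C` on `S` multiplies its permutation on the right by the involution `s` exchanging the chord ends
over `S`, and `1 - P_s = ∑ w_v w_vᵀ` has low rank. The matrix determinant lemma turns the ratio into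
an `S × S` determinant (`det_circleMatrix_mul`), whose matrix is `-A[S,S] = A[S,S]ᵀ`
(`signedInterlacement_apply`, `signedInterlacement_transpose`). -/

section CircleMatrix

/-! ### Determinants detecting one-cycle permutations. -/

variable {E : Type*} [Fintype E] [DecidableEq E]

/-- The matrix `1 - P + J`, with `P` the permutation matrix of `g` and `J` the all-ones matrix.
It is invertible if and only if `g` has exactly one cycle. -/
def circleMatrix (g : Equiv.Perm E) : Matrix E E ℝ :=
  Matrix.of fun a b => (if a = b then 1 else 0) - (if a = g b then 1 else 0) + 1

theorem circleMatrix_mulVec (g : Equiv.Perm E) (x : E → ℝ) (a : E) :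
    (circleMatrix g).mulVec x a = x a - x (g⁻¹ a) + ∑ b, x b := by
  have h : ∀ b, a = g b ↔ g⁻¹ a = b := fun b => by
    rw [Equiv.Perm.inv_eq_iff_eq]
  simp [circleMatrix, Matrix.mulVec, dotProduct, add_mul, sub_mul, Finset.sum_add_distrib,
    Finset.sum_sub_distrib, h]

theorem det_circleMatrix_conj (g h : Equiv.Perm E) :
    (circleMatrix (h * g * h⁻¹)).det = (circleMatrix g).det := by
  rw [← Matrix.det_submatrix_equiv_self h (circleMatrix (h * g * h⁻¹))]
  congr 1
  ext a b
  simp [circleMatrix]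

theorem det_circleMatrix_ne_zero {g : Equiv.Perm E} (hg : ∀ e f, g.SameCycle e f) :
    (circleMatrix g).det ≠ 0 := by
  intro h0
  obtain ⟨x, hx, hMx⟩ := Matrix.exists_mulVec_eq_zero_iff.2 h0
  apply hx
  have hrow : ∀ a, x a - x (g⁻¹ a) + ∑ b, x b = 0 := fun a => by
    rw [← circleMatrix_mulVec, hMx]; rfl
  have hsum : ∑ a, x (g⁻¹ a) = ∑ a, x a := Equiv.sum_comp g⁻¹ x
  ext e
  have hpos : 0 < Fintype.card E := Fintype.card_pos_iff.2 ⟨e⟩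
  -- Summing all rows cancels the differences and leaves `card E * ∑ x = 0`.
  have htot : ∑ b, x b = 0 := by
    have h1 : ∑ a, (x a - x (g⁻¹ a) + ∑ b, x b) = 0 := Finset.sum_eq_zero fun a _ => hrow a
    rw [Finset.sum_add_distrib, Finset.sum_sub_distrib, hsum, sub_self, zero_add] at h1
    simpa [hpos.ne'] using h1
  have hstep : ∀ a, x (g a) = x a := fun a => by
    have := hrow (g a)
    rw [Equiv.Perm.inv_eq_iff_eq.2 (rfl : g a = g a), htot] at this
    linarith
  have hpow : ∀ (n : ℕ) a, x ((g ^ n) a) = x a := by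
    intro n
    induction n with
    | zero => simp
    | succ k ih => intro a; rw [pow_succ, Equiv.Perm.mul_apply, ih, hstep]
  have hconst : ∀ a, x a = x e := fun a => by
    obtain ⟨n, hn⟩ := (hg e a).exists_nat_pow_eq
    rw [← hn, hpow]
  simp only [hconst, Finset.sum_const, Finset.card_univ, nsmul_eq_mul, mul_eq_zero,
    Nat.cast_eq_zero, hpos.ne', false_or] at htot
  simpa using htot

theorem det_circleMatrix_eq_zero {g : Equiv.Perm E} (hg : ¬ ∀ e f, g.SameCycle e f) :
    (circleMatrix g).det = 0 := by
  classical
  push Not at hg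
  obtain ⟨e, f, hef⟩ := hg
  let k : ℝ := ∑ a, if g.SameCycle e a then 1 else 0
  have hpos : (0 : ℝ) < Fintype.card E := Nat.cast_pos.2 (Fintype.card_pos_iff.2 ⟨e⟩)
  -- The centred indicator of the cycle of `e`: constant on cycles, so `1 - P` kills it; of total
  -- zero, so `J` kills it.
  refine Matrix.exists_mulVec_eq_zero_iff.1
    ⟨fun a => Fintype.card E * (if g.SameCycle e a then 1 else 0) - k, fun h0 => ?_, ?_⟩
  · have h1 := congrFun h0 e
    have h2 := congrFun h0 f
    simp only [Equiv.Perm.SameCycle.refl, if_true, hef, if_false, Pi.zero_apply] at h1 h2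
    linarith
  · ext a
    rw [circleMatrix_mulVec]
    rw [Finset.sum_sub_distrib, ← Finset.mul_sum]
    simp [Equiv.Perm.sameCycle_symm_apply_right, k]

/-- Both are full cycles, hence conjugate. Nontriviality matters because `IsCycle` excludes the
identity. -/
theorem det_circleMatrix_congr [Nontrivial E] {g h : Equiv.Perm E}
    (hg : ∀ e f, g.SameCycle e f) (hh : ∀ e f, h.SameCycle e f) :
    (circleMatrix g).det = (circleMatrix h).det := by
  have key : ∀ {k : Equiv.Perm E}, (∀ e f, k.SameCycle e f) →
      k.IsCycle ∧ k.support = Finset.univ := by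
    intro k hk
    have hon : k.IsCycleOn (Set.univ : Set E) :=
      ⟨k.bijective.bijOn_univ, fun _ _ _ _ => hk _ _⟩
    refine ⟨Equiv.Perm.isCycle_iff_exists_isCycleOn.2
      ⟨_, Set.nontrivial_univ, hon, fun _ _ => trivial⟩, ?_⟩
    ext a
    simpa using hon.apply_ne Set.nontrivial_univ (Set.mem_univ a)
  obtain ⟨c, hc⟩ := isConj_iff.1 <| (key hg).1.isConj (key hh).1 (by rw [(key hg).2, (key hh).2])
  rw [← hc, det_circleMatrix_conj]

/-- If `x - P x = P w` column by column, then composing `ρ` with a permutation `s` whose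
permutation matrix is `1 - w wᵀ` changes the determinant of the circle matrix by the factor
`det (1 + wᵀ x)`. -/
theorem det_circleMatrix_mul {ι : Type*} [Fintype ι] [DecidableEq ι] (ρ s : Equiv.Perm E)
    (w y : ι → E → ℝ)
    (hs : ∀ b c, (if c = b then 1 else 0) - (if c = s b then 1 else 0) = ∑ v, w v c * w v b)
    (hw : ∀ v, ∑ b, w v b = 0)
    (hy : ∀ v c, y v (ρ c) - y v c = w v c) :
    (circleMatrix (ρ * s)).det =
      (circleMatrix ρ).det * (1 + Matrix.of fun u v => ∑ b, w u b * y v b : Matrix ι ι ℝ).det := by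
  obtain hE | hE := isEmpty_or_nonempty E
  · simp [show (Matrix.of fun _ _ => 0 : Matrix ι ι ℝ) = 0 from rfl]
  have hcard : (Fintype.card E : ℝ) ≠ 0 := Nat.cast_ne_zero.2 Fintype.card_ne_zero
  -- Centring the columns makes `J * X = 0`; it does not affect `W * X`, as each `w v` has sum zero.
  let X : Matrix E ι ℝ := Matrix.of fun a v => y v a - (∑ b, y v b) / Fintype.card E
  let W : Matrix ι E ℝ := Matrix.of w
  have hWX : (Matrix.of fun u v => ∑ b, w u b * y v b : Matrix ι ι ℝ) = W * X := by
    ext u v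
    simp [Matrix.mul_apply, W, X, mul_sub, Finset.sum_sub_distrib, ← Finset.sum_mul, hw]
  have hMX : ∀ a v, (circleMatrix ρ * X) a v = w v (ρ⁻¹ a) := by
    intro a v
    have h1 : (circleMatrix ρ * X) a v = (circleMatrix ρ).mulVec (fun b => X b v) a := rfl
    rw [h1, circleMatrix_mulVec, ← hy]
    simp [X, Finset.sum_sub_distrib, mul_div_cancel₀ _ hcard]
  have hfac : circleMatrix (ρ * s) = circleMatrix ρ * (1 + X * W) := by
    rw [Matrix.mul_add, Matrix.mul_one, ← Matrix.mul_assoc]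
    ext a b
    rw [Matrix.add_apply, Matrix.mul_apply]
    simp only [hMX]
    have h2 : (if a = ρ b then (1 : ℝ) else 0) - (if a = ρ (s b) then 1 else 0) =
        ∑ v, w v (ρ⁻¹ a) * w v b := by
      rw [← hs]
      simp only [Equiv.Perm.inv_eq_iff_eq]
    have h3 : circleMatrix (ρ * s) a b =
      (if a = b then 1 else 0) - (if a = ρ (s b) then 1 else 0) + 1 := rfl
    simp only [W, Matrix.of_apply, ← h2]
    rw [h3, circleMatrix, Matrix.of_apply]
    ring
  rw [hfac, Matrix.det_mul, Matrix.det_one_add_mul_comm, hWX]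

end CircleMatrix

/-! ### Linear positions on the tour circle. -/

section Position

variable {E : Type*} [Fintype E]

theorem exists_position [Nonempty E] {ρ : Equiv.Perm E} (hρ : ∀ e f, ρ.SameCycle e f) :
    ∃ p : E → ℕ, Function.Injective p ∧ (∀ e, p e < Fintype.card E) ∧
      ∀ e i, p ((ρ ^ i) e) = (p e + i) % Fintype.card E := by
  obtain ⟨o⟩ := ‹Nonempty E›
  have hon : ρ.IsCycleOn ((Finset.univ : Finset E) : Set E) := by
    rw [Finset.coe_univ]
    exact ⟨ρ.bijective.bijOn_univ, fun _ _ _ _ => hρ _ _⟩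
  have hex : ∀ b, ∃ n < Fintype.card E, (ρ ^ n) o = b := fun b =>
    hon.exists_pow_eq (by simp) (by simp)
  choose p hp hpo using hex
  refine ⟨p, fun a b hab => by rw [← hpo a, hab, hpo b], hp, fun e i => ?_⟩
  have h1 : (ρ ^ p ((ρ ^ i) e)) o = (ρ ^ (p e + i)) o := by
    rw [hpo, add_comm, pow_add, Equiv.Perm.mul_apply, hpo]
  have h2 := (hon.pow_apply_eq_pow_apply (Finset.mem_univ o)).1 h1
  rw [Finset.card_univ] at h2
  rw [← h2, Nat.mod_eq_of_lt (hp _)]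

theorem DiMultigraph.mem_openArc_iff {ρ : Equiv.Perm E} {p : E → ℕ}
    (hinj : Function.Injective p) (hlt : ∀ e, p e < Fintype.card E)
    (hp : ∀ e i, p ((ρ ^ i) e) = (p e + i) % Fintype.card E) {x y z : E} :
    z ∈ DiMultigraph.openArc ρ x y ↔
      (p x < p z ∧ p z < p y) ∨ (p z < p y ∧ p y < p x) ∨ (p y < p x ∧ p x < p z) := by
  have hstep : ∀ a b i, (ρ ^ i) a = b ↔ (p a + i) % Fintype.card E = p b := fun a b i => by
    rw [← hp, hinj.eq_iff]
  have hx := hlt x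
  have hy := hlt y
  have hz := hlt z
  simp only [DiMultigraph.openArc, Set.mem_ofPred_eq, hstep]
  generalize Fintype.card E = N at *
  have hmod : ∀ a i, a < N → i < N → (a + i) % N = if a + i < N then a + i else a + i - N := by
    intro a i ha hi
    split_ifs with h
    · exact Nat.mod_eq_of_lt h
    · rw [Nat.mod_eq_sub_mod (by omega), Nat.mod_eq_of_lt (by omega)]
  constructor
  · rintro ⟨i, k, h0, hik, hk, h1, h2⟩
    rw [hmod _ _ hx (by omega)] at h1 h2
    split_ifs at h1 h2 <;> omega
  · intro h
    -- The forward distances from `x` to `z` and to `y`, modulo `N`.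
    refine ⟨if p x < p z then p z - p x else p z + N - p x,
      if p x < p y then p y - p x else p y + N - p x, ?_, ?_, ?_, ?_, ?_⟩
    · split_ifs <;> omega
    · split_ifs <;> omega
    · split_ifs <;> omega
    · rw [hmod _ _ hx (by split_ifs <;> omega)]
      split_ifs <;> omega
    · rw [hmod _ _ hx (by split_ifs <;> omega)]
      split_ifs <;> omega

/-- The difference of the indicators of the positions after `a` and after `b` increases by one when
`ρ` leaves `a`, decreases by one when `ρ` leaves `b`, and is otherwise unchanged along `ρ`. -/
theorem passage_step [DecidableEq E] {ρ : Equiv.Perm E} {p : E → ℕ}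
    (hinj : Function.Injective p) (hlt : ∀ e, p e < Fintype.card E)
    (hp : ∀ e i, p ((ρ ^ i) e) = (p e + i) % Fintype.card E) (a b c : E) :
    (((if p a < p (ρ c) then 1 else 0) - (if p b < p (ρ c) then 1 else 0)) -
      ((if p a < p c then 1 else 0) - (if p b < p c then 1 else 0)) : ℝ) =
      (if c = a then 1 else 0) - (if c = b then 1 else 0) := by
  -- At the wrap to 0 both indicators reset, and the two resets cancel in the difference except at
  -- `a` and `b`.
  have h1 : p (ρ c) = if p c + 1 < Fintype.card E then p c + 1 else 0 := by
    have := hp c 1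
    rw [pow_one] at this
    rw [this]
    have := hlt c
    split_ifs with h
    · exact Nat.mod_eq_of_lt h
    · rw [show p c + 1 = Fintype.card E by omega, Nat.mod_self]
  have ha := hlt a
  have hb := hlt b
  have hc := hlt c
  rw [h1]
  simp only [← hinj.eq_iff]
  clear h1 hp
  split_ifs <;> first | omega | norm_num

end Position

/-! ### Flips as exchanges of chord ends. -/

namespace DiMultigraph

variable {V E : Type*}

theorem swapTwo_eq_iff_ne {X : Type*} (h : Nat.card X = 2) {x y : X} :
    swapTwo h x = y ↔ y ≠ x := by
  refine ⟨fun hxy => hxy ▸ swapTwo_ne h x, fun hyx => ?_⟩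
  by_contra hne
  have hfin : Finite X := Nat.finite_of_card_ne_zero (by omega)
  obtain ⟨e⟩ : Nonempty (X ≃ Fin 2) := ⟨Finite.equivFinOfCardEq h⟩
  have h1 := e.injective.ne hyx
  have h2 := e.injective.ne hne
  have h3 := e.injective.ne (swapTwo_ne h x)
  omega

/-- This moves an exchange of outgoing arcs back to the incoming arcs, which are the chord ends. -/
theorem swapTwo_apply_equiv {X Y : Type*} (hX : Nat.card X = 2) (hY : Nat.card Y = 2)
    (f : X ≃ Y) (x : X) : swapTwo hY (f x) = f (swapTwo hX x) :=
  (swapTwo_eq_iff_ne hY).2 (f.injective.ne (swapTwo_ne hX x))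

theorem flip_bijective [Fintype V] [DecidableEq V] {H : DiMultigraph V E}
    (hH : H.IsTwoInTwoOut) (C : H.TransitionSystem) : Function.Bijective (flip hH C) := by
  classical
  have hne : ∀ v, (C v).trans (swapTwo (hH.card_out v)) ≠ C v := fun v h => by
    have : Nonempty (H.InArc v) := (Nat.card_pos_iff.1 (by rw [hH.card_in v]; omega)).1
    obtain ⟨e⟩ := this
    exact swapTwo_ne _ _ (DFunLike.congr_fun h e)
  have hmem : ∀ S v, v ∈ S ↔ flip hH C S v ≠ C v := fun S v => by
    by_cases hv : v ∈ S <;> simp [flip, hv, hne]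
  refine ⟨fun S T hST => Finset.ext fun v => by rw [hmem, hST, ← hmem], fun τ => ?_⟩
  -- Only two bijections exist at each vertex, so `τ` is determined by where it differs from `C`.
  refine ⟨Finset.univ.filter fun v => τ v ≠ C v, funext fun v => ?_⟩
  by_cases hv : τ v = C v
  · simp [flip, hv]
  · obtain ⟨x, hx⟩ : ∃ x, τ v x ≠ C v x := by
      by_contra! h
      exact hv (Equiv.ext h)
    simp only [flip, Finset.mem_filter, Finset.mem_univ, true_and, ne_eq, hv, not_false_eq_true,
      if_true]
    ext1 y
    rw [Equiv.trans_apply, swapTwo_eq_iff_ne]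
    by_cases hxy : y = x
    · rwa [hxy]
    · have h1 := (swapTwo_eq_iff_ne (hH.card_in v)).2 hxy
      rw [← h1, ← swapTwo_apply_equiv _ (hH.card_out v), ← swapTwo_apply_equiv _ (hH.card_out v)]
      exact (swapTwo _).injective.ne hx

theorem otherEnd_ne {H : DiMultigraph V E} (hH : H.IsTwoInTwoOut) (t : ∀ v, H.InArc v) (v : V) :
    (otherEnd hH t v : E) ≠ t v :=
  fun h => swapTwo_ne _ _ (Subtype.ext h)

theorem eq_tail_or_eq_otherEnd {H : DiMultigraph V E} (hH : H.IsTwoInTwoOut)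
    (t : ∀ v, H.InArc v) {v : V} (e : H.InArc v) :
    (e = t v ∧ swapTwo (hH.card_in v) e = otherEnd hH t v) ∨
      (e = otherEnd hH t v ∧ swapTwo (hH.card_in v) e = t v) := by
  by_cases h : e = t v
  · exact Or.inl ⟨h, h ▸ rfl⟩
  · exact Or.inr ⟨((swapTwo_eq_iff_ne _).2 h).symm, (swapTwo_eq_iff_ne _).2 (Ne.symm h)⟩

theorem inducedPerm_flip [DecidableEq V] {H : DiMultigraph V E} (hH : H.IsTwoInTwoOut)
    (C : H.TransitionSystem) (S : Finset V) (e : E) :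
    inducedPerm (flip hH C S) e = inducedPerm C
      (if H.target e ∈ S then (swapTwo (hH.card_in (H.target e)) ⟨e, rfl⟩ : E) else e) := by
  have key : ∀ (v : V) (f : H.InArc v), inducedPerm C (f : E) = (C v f : E) := by
    rintro _ ⟨f, rfl⟩
    rfl
  rw [inducedPerm_apply]
  by_cases h : H.target e ∈ S
  · simp only [flip, h, if_true, Equiv.trans_apply, key]
    rw [swapTwo_apply_equiv (hH.card_in _)]
  · simp [flip, h, inducedPerm_apply]

/-- The permutation exchanging the two incoming arcs at every vertex of `S` has permutation matrix
`1 - ∑ v ∈ S, w v (w v)ᵀ`, where `w v` is the difference of the indicators of the chord ends. -/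
theorem one_sub_exchange [DecidableEq V] [DecidableEq E] {H : DiMultigraph V E}
    (hH : H.IsTwoInTwoOut) (t : ∀ v, H.InArc v) (S : Finset V) (b c : E) :
    ((if c = b then 1 else 0) - (if c = (if H.target b ∈ S then
      (swapTwo (hH.card_in (H.target b)) ⟨b, rfl⟩ : E) else b) then 1 else 0) : ℝ) =
      ∑ v : S, ((if c = t v then 1 else 0) - (if c = otherEnd hH t v then 1 else 0)) *
        ((if b = t v then 1 else 0) - (if b = otherEnd hH t v then 1 else 0)) := by
  have hzero : ∀ v, v ≠ H.target b → b ≠ t v ∧ b ≠ otherEnd hH t v := fun v hv =>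
    ⟨fun h => hv (by rw [h, (t v).2]), fun h => hv (by rw [h, (otherEnd hH t v).2])⟩
  by_cases hS : H.target b ∈ S
  · rw [Finset.sum_eq_single (⟨H.target b, hS⟩ : S)]
    · have hne := otherEnd_ne hH t (H.target b)
      simp only [hS, if_true]
      obtain ⟨h1, h2⟩ | ⟨h1, h2⟩ := eq_tail_or_eq_otherEnd hH t (⟨b, rfl⟩ : H.InArc (H.target b))
      · have h1' : b = t (H.target b) := congrArg Subtype.val h1
        rw [h2]
        generalize (t (H.target b) : E) = x at *
        generalize (otherEnd hH t (H.target b) : E) = y at *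
        subst h1'
        simp [hne.symm]
      · have h1' : b = otherEnd hH t (H.target b) := congrArg Subtype.val h1
        rw [h2]
        generalize (t (H.target b) : E) = x at *
        generalize (otherEnd hH t (H.target b) : E) = y at *
        subst h1'
        simp [hne]
    · rintro ⟨v, hv⟩ - hvb
      have := hzero v fun h => hvb (Subtype.ext h)
      simp [this.1, this.2]
    · simp
  · rw [Finset.sum_eq_zero]
    · simp [hS]
    · rintro ⟨v, hv⟩ -
      have := hzero v fun h => hS (h ▸ hv)
      simp [this.1, this.2]

/-! ### The signed interlacement matrix in terms of positions. -/

/-- The right side is an entry of `-(1 + W * X)`: the passage function of `v` at `t u` minus its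
value at the other end of `u`. For `u = v` this difference is `-1` and cancels the identity; for `u
≠ v` it vanishes unless the chords cross. -/
theorem signedInterlacement_apply [Fintype E] [DecidableEq V] {H : DiMultigraph V E}
    (hH : H.IsTwoInTwoOut) (t : ∀ v, H.InArc v) {ρ : Equiv.Perm E} {p : E → ℕ}
    (hinj : Function.Injective p) (hlt : ∀ e, p e < Fintype.card E)
    (hp : ∀ e i, p ((ρ ^ i) e) = (p e + i) % Fintype.card E) (u v : V) :
    signedInterlacement hH ρ t u v = -((if u = v then 1 else 0) +
      (((if p (t v) < p (t u) then 1 else 0) - (if p (otherEnd hH t v) < p (t u) then 1 else 0)) -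
      ((if p (t v) < p (otherEnd hH t u) then 1 else 0) -
        (if p (otherEnd hH t v) < p (otherEnd hH t u) then 1 else 0)))) := by
  have hu := hinj.ne (otherEnd_ne hH t u)
  have hv := hinj.ne (otherEnd_ne hH t v)
  by_cases huv : u = v
  · subst huv
    simp only [signedInterlacement, Matrix.of_apply, if_true, lt_irrefl, if_false]
    split_ifs <;> first | omega | norm_num
  · have hdist : ∀ (e : H.InArc u) (f : H.InArc v), p e ≠ p f := fun e f =>
      hinj.ne fun h => huv (by rw [← e.2, ← f.2, h])
    have h1 := hdist (t u) (t v)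
    have h2 := hdist (t u) (otherEnd hH t v)
    have h3 := hdist (otherEnd hH t u) (t v)
    have h4 := hdist (otherEnd hH t u) (otherEnd hH t v)
    simp only [signedInterlacement, Matrix.of_apply, huv, if_false, Interlaced,
      mem_openArc_iff hinj hlt hp]
    clear hdist hp hlt
    generalize p (t u) = a at *
    generalize p (t v) = b at *
    generalize p (otherEnd hH t u) = c at *
    generalize p (otherEnd hH t v) = d at *
    rcases hu.lt_or_gt with hu | hu <;> rcases hv.lt_or_gt with hv | hv <;>
      rcases h1.lt_or_gt with h1 | h1 <;> rcases h2.lt_or_gt with h2 | h2 <;>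
      rcases h3.lt_or_gt with h3 | h3 <;> rcases h4.lt_or_gt with h4 | h4 <;>
      first
      | (exfalso; omega)
      | simp [hu, h1, h2, h3, h4, hu.not_gt, h1.not_gt, h2.not_gt, h3.not_gt, h4.not_gt]

theorem signedInterlacement_transpose [Fintype E] [DecidableEq V] {H : DiMultigraph V E}
    (hH : H.IsTwoInTwoOut) (t : ∀ v, H.InArc v) {ρ : Equiv.Perm E} [Nonempty E]
    (hρ : ∀ e f, ρ.SameCycle e f) :
    (signedInterlacement hH ρ t).transpose = -signedInterlacement hH ρ t := by
  obtain ⟨p, hinj, hlt, hp⟩ := exists_position hρ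
  ext u v
  rw [Matrix.transpose_apply, Matrix.neg_apply, signedInterlacement_apply hH t hinj hlt hp,
    signedInterlacement_apply hH t hinj hlt hp]
  by_cases huv : u = v
  · subst huv
    have hu := hinj.ne (otherEnd_ne hH t u)
    simp only [if_true, lt_irrefl, if_false]
    split_ifs <;> first | omega | norm_num
  · have hdist : ∀ (e : H.InArc u) (f : H.InArc v), p e ≠ p f := fun e f =>
      hinj.ne fun h => huv (by rw [← e.2, ← f.2, h])
    have h1 := hdist (t u) (t v)
    have h2 := hdist (t u) (otherEnd hH t v)
    have h3 := hdist (otherEnd hH t u) (t v)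
    have h4 := hdist (otherEnd hH t u) (otherEnd hH t v)
    -- Exchanging `u` and `v` reverses each comparison, replacing an indicator by 1 minus it; the
    -- four constants cancel.
    simp only [huv, Ne.symm huv, if_false]
    clear hdist hp hlt
    generalize p (t u) = a at *
    generalize p (t v) = b at *
    generalize p (otherEnd hH t u) = c at *
    generalize p (otherEnd hH t v) = d at *
    rcases h1.lt_or_gt with h1 | h1 <;> rcases h2.lt_or_gt with h2 | h2 <;>
      rcases h3.lt_or_gt with h3 | h3 <;> rcases h4.lt_or_gt with h4 | h4 <;>
      simp [h1, h2, h3, h4, h1.not_gt, h2.not_gt, h3.not_gt, h4.not_gt]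

/-! ### Principal minors and Eulerian tours. -/

/-- The principal minors of the signed interlacement matrix compare the circle matrix of the
tour with the circle matrix of the tour composed with an exchange of chord ends. -/
theorem det_circleMatrix_mul_exchange [Fintype E] [DecidableEq V] [DecidableEq E] [Nonempty E]
    {H : DiMultigraph V E} (hH : H.IsTwoInTwoOut) (t : ∀ v, H.InArc v) {ρ s : Equiv.Perm E}
    (hρ : ∀ e f, ρ.SameCycle e f) (S : Finset V)
    (hs : ∀ e, s e = if H.target e ∈ S then
      (swapTwo (hH.card_in (H.target e)) ⟨e, rfl⟩ : E) else e) :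
    (circleMatrix (ρ * s)).det =
      (circleMatrix ρ).det * principalDet (signedInterlacement hH ρ t) S := by
  obtain ⟨p, hinj, hlt, hp⟩ := exists_position hρ
  rw [det_circleMatrix_mul (ι := S) ρ s
    (fun v c => (if c = t v then 1 else 0) - (if c = otherEnd hH t v then 1 else 0))
    (fun v a => (if p (t v) < p a then 1 else 0) - (if p (otherEnd hH t v) < p a then 1 else 0))
    (fun b c => by rw [hs]; exact one_sub_exchange hH t S b c)
    (fun v => by simp [Finset.sum_sub_distrib])
    (fun v c => passage_step hinj hlt hp _ _ _)]
  congr 1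
  -- Transposing absorbs the sign in `1 + W * X = -A[S,S]`, so no parity of `S` enters.
  rw [principalDet, ← Matrix.det_transpose (Matrix.submatrix _ _ _), Matrix.transpose_submatrix,
    signedInterlacement_transpose hH t hρ]
  congr 1
  ext u v
  rw [Matrix.submatrix_apply, Matrix.neg_apply, signedInterlacement_apply hH t hinj hlt hp]
  simp only [Matrix.add_apply, Matrix.one_apply, Matrix.of_apply, sub_mul, ite_mul, one_mul,
    zero_mul, Finset.sum_sub_distrib, Finset.sum_ite_eq', Finset.mem_univ, if_true, neg_neg,
    Subtype.ext_iff]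

theorem principalDet_signedInterlacement [Fintype E] [DecidableEq V]
    {H : DiMultigraph V E} (hH : H.IsTwoInTwoOut) {C : H.TransitionSystem}
    (hC : IsEulerianTour C) {ρ : Equiv.Perm E} (hρ : ρ = inducedPerm C ∨ ρ = (inducedPerm C)⁻¹)
    (t : ∀ v, H.InArc v) (S : Finset V) [Decidable (IsEulerianTour (flip hH C S))] :
    principalDet (signedInterlacement hH ρ t) S =
      if IsEulerianTour (flip hH C S) then 1 else 0 := by
  classical
  have hE := hC.1
  have hnt : Nontrivial E := by
    obtain ⟨e⟩ := hE
    have := swapTwo_ne (hH.card_in (H.target e)) ⟨e, rfl⟩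
    exact ⟨_, _, fun h => this (Subtype.ext h)⟩
  have hcyc : ∀ e f, ρ.SameCycle e f := by
    obtain rfl | rfl := hρ
    · exact hC.2
    · exact fun e f => (hC.2 e f).inv
  -- The exchange of chord ends over `S`; it is the same for both orientations.
  let s : Equiv.Perm E := (inducedPerm C)⁻¹ * inducedPerm (flip hH C S)
  have hs : ∀ e, s e = if H.target e ∈ S then
      (swapTwo (hH.card_in (H.target e)) ⟨e, rfl⟩ : E) else e := fun e => by
    rw [Equiv.Perm.mul_apply, Equiv.Perm.inv_eq_iff_eq, inducedPerm_flip]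
  have hflip : (∀ e f, (ρ * s).SameCycle e f) ↔ IsEulerianTour (flip hH C S) := by
    obtain rfl | rfl := hρ
    · rw [mul_inv_cancel_left]
      exact ⟨fun h => ⟨hE, h⟩, fun h => h.2⟩
    · have harc : ∀ (v : V) (f : H.InArc v),
          s f = if v ∈ S then (swapTwo (hH.card_in v) f : E) else f := by
        rintro _ ⟨f, rfl⟩
        exact hs f
      have hinv : s⁻¹ = s := by
        refine inv_eq_of_mul_eq_one_left (Equiv.ext fun e => ?_)
        have he := hs e
        rw [Equiv.Perm.mul_apply]
        by_cases hv : H.target e ∈ S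
        · rw [he, if_pos hv, harc, if_pos hv, (swapTwo_eq_iff_ne _).2 (swapTwo_ne _ _).symm]
          rfl
        · rw [he, if_neg hv, he, if_neg hv]
          rfl
      -- For the reversed circle, `ρ * s` is only conjugate to the inverse of the flipped
      -- permutation, which has as many cycles.
      have hconj : (inducedPerm C)⁻¹ * s = s * (inducedPerm (flip hH C S))⁻¹ * s⁻¹ := by
        nth_rw 1 [← hinv]
        simp only [s, mul_inv_rev, inv_inv]
        group
      simp only [hconj, Equiv.Perm.sameCycle_conj, Equiv.Perm.sameCycle_inv]
      refine ⟨fun h => ⟨hE, fun e f => ?_⟩, fun h e f => h.2 _ _⟩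
      simpa using h (s e) (s f)
  have hdet := det_circleMatrix_mul_exchange hH t hcyc S hs
  have hne := det_circleMatrix_ne_zero hcyc
  split_ifs with h
  · rw [det_circleMatrix_congr (hflip.2 h) hcyc] at hdet
    exact (mul_eq_left₀ hne).1 hdet.symm
  · rw [det_circleMatrix_eq_zero (mt hflip.1 h)] at hdet
    exact (mul_eq_zero.1 hdet.symm).resolve_left hne

end DiMultigraph

/-! ### The representation theorem and the uniform measure. -/

theorem mainTheorem5 {V E : Type*} [Fintype V] [DecidableEq V] [Fintype E]
    (H : DiMultigraph V E) (hH : H.IsTwoInTwoOut)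
    (C : H.TransitionSystem) (hC : C ∈ H.eulerianTours)
    (ρ : Equiv.Perm E)
    (hρ : ρ = DiMultigraph.inducedPerm C ∨ ρ = (DiMultigraph.inducedPerm C)⁻¹)
    (t : ∀ v, H.InArc v)
    (A : Matrix V V ℝ) (hA : A = DiMultigraph.signedInterlacement hH ρ t) :
    A.transpose = -A ∧
    (∀ S : Finset V, principalDet A S = 0 ∨ principalDet A S = 1) ∧
    (∀ S : Finset V, principalDet A S = 1 ↔ DiMultigraph.flip hH C S ∈ H.eulerianTours) ∧
    Function.Bijective (DiMultigraph.flip hH C) ∧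
    0 < ∑ T : Finset V, principalDet A T ∧
    ∀ S : Finset V,
      (PMF.uniformOfFinset H.eulerianTours ⟨C, hC⟩ (DiMultigraph.flip hH C S)).toReal =
        skewDetMeasure A S := by
  classical
  subst hA
  have hC' : DiMultigraph.IsEulerianTour C := (H.mem_eulerianTours C).1 hC
  have hE := hC'.1
  have hcyc : ∀ e f, ρ.SameCycle e f := by
    obtain rfl | rfl := hρ
    · exact hC'.2
    · exact fun e f => (hC'.2 e f).inv
  have hdet : ∀ S, principalDet (DiMultigraph.signedInterlacement hH ρ t) S =
      if DiMultigraph.flip hH C S ∈ H.eulerianTours then 1 else 0 := fun S => by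
    simp only [DiMultigraph.principalDet_signedInterlacement hH hC' hρ t,
      DiMultigraph.mem_eulerianTours]
  have hbij := DiMultigraph.flip_bijective hH C
  -- The minors are indicators of tours, so bijectivity of the flip makes the normalizing sum the
  -- number of tours, positive because `C` is one.
  have hsum : ∑ T, principalDet (DiMultigraph.signedInterlacement hH ρ t) T =
      H.eulerianTours.card := by
    rw [Finset.sum_congr rfl fun T _ => hdet T, Finset.sum_boole]
    congr 1
    refine Finset.card_bij (fun T _ => DiMultigraph.flip hH C T) (by simp)
      (fun _ _ _ _ h => hbij.1 h) fun τ hτ => ?_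
    obtain ⟨T, rfl⟩ := hbij.2 τ
    exact ⟨T, by simpa using hτ, rfl⟩
  refine ⟨DiMultigraph.signedInterlacement_transpose hH t hcyc, fun S => ?_, fun S => ?_, hbij, ?_,
    fun S => ?_⟩
  · rw [hdet]
    split_ifs <;> simp
  · rw [hdet]
    split_ifs with h <;> simp [h]
  · rw [hsum]
    exact_mod_cast Finset.card_pos.2 ⟨C, hC⟩
  · rw [skewDetMeasure, hsum, hdet]
    split_ifs with h
    · refine (congrArg ENNReal.toReal (PMF.uniformOfFinset_apply_of_mem ⟨C, hC⟩ h)).trans ?_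
      simp
    · refine (congrArg ENNReal.toReal (PMF.uniformOfFinset_apply_of_notMem ⟨C, hC⟩ h)).trans ?_
      simp
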